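/- Let $d\ge 1$, $s\in(1/2,1)$, $m>1$, $f\in C(\mathbb R^d)$ and $H\in C(\mathbb R^d\times\mathbb R^d)$. Assume that for some constant $\kappa>0$ $$\tfrac1\kappa|p|^m-\kappa\le H(x,p)\le\kappa(1+|p|^m)\qquad\text{for all }x,p\in\mathbb R^d,$$ and that for some constants $\kappa_0>0$ and $\kappa_1\in\mathbb R$ $$f(x)\ge\kappa_0|x|^{m(2s-1)}\qquad\text{for all }|x|\ge\kappa_1 .$$ Let $I=-(-\Delta)^s$, with kernel $K(y)=c_{d,s}|y|^{-(d+2s)}$, $c_{d,s}=\frac{4^s\Gamma(d/2+s)}{\pi^{d/2}|\Gamma(-s)|}$, and let $L^1(\omega_s)$ be the space of $u\in L^1_{\rm loc}(\mathbb R^d)$ with $\int_{\mathbb R^d}\frac{|u(y)|}{1+|y|^{d+2s}}\,dy<\infty$. For $E\subset\mathbb R^d$ measurable put $I[E](v,p,x)=\int_E\big(v(x+y)-v(x)-\chi_{B_1(0)}(y)\,y\cdot p\big)K(y)\,dy$. For $u\in C(\mathbb R^d)\cap L^1(\omega_s)$ and $\lambda\in\mathbb R$, the inequality $$-Iu+H(x,\nabla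 u)\ge f-\lambda\quad\text{in }\mathbb R^d \qquad (*)$$ is understood in the viscosity sense: whenever $x_0\in\mathbb R^d$, $\delta>0$, $\varphi$ is of class $C^2$ in a neighbourhood of $\overline{B_\delta(x_0)}$, and $u-\varphi$ attains at $x_0$ its minimum over $B_\delta(x_0)$, then $$-I[B_\delta(0)](\varphi,\nabla\varphi(x_0),x_0)-I[B_\delta(0)^c](u,\nabla\varphi(x_0),x_0)+H(x_0,\nabla\varphi(x_0))\ge f(x_0)-\lambda .$$ Then there is no pair $(u,\lambda)\in\big(C(\mathbb R^d)\cap L^1(\omega_s)\big)\times\mathbb R$ with $u\ge0$ satisfying $(*)$. Consequently the critical value $$\lambda^*=\inf\{\lambda\in\mathbb R:\ \text{there is } u\in C(\mathbb R^d)\cap L^1(\omega_s),\ u\ge 0,\ \text{satisfying }(*)\}$$ equals $+\infty$ (with $\inf\emptyset=+\infty$). -/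

import Mathlib

open MeasureTheory Metric

noncomputable section

namespace FracErgodic

/-- The space `ℝ^d` with its Euclidean norm. -/
abbrev Rd (d : ℕ) : Type := EuclideanSpace ℝ (Fin d)

/-- The normalizing constant `c_{d,s} = 4^s Γ(d/2 + s) / (π^{d/2} |Γ(-s)|)` of the fractional
Laplacian of order `2s`. -/
def fracConst (d : ℕ) (s : ℝ) : ℝ :=
  (4 : ℝ) ^ s * Real.Gamma ((d : ℝ) / 2 + s) /
    (Real.pi ^ ((d : ℝ) / 2) * |Real.Gamma (-s)|)

/-- The kernel `K(y) = c_{d,s} |y|^{-(d+2s)}` of `I = -(-Δ)^s`. -/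
def fracKernel (d : ℕ) (s : ℝ) (y : Rd d) : ℝ :=
  fracConst d s * ‖y‖ ^ (-((d : ℝ) + 2 * s))

/-- The nonlocal evaluation
`I[E](u, p, x) = ∫_E (u(x+y) - u(x) - χ_B(y) y·p) K(y) dy`, where `B` is the unit ball.
When `K` is radial, `E` is the whole space, `u` is smooth at `x` and `p = ∇u(x)`, the first order
term cancels in the principal value, so that with `K = fracKernel d s` this is `-(-Δ)^s u(x)`. -/
def nonlocalEval {d : ℕ} (K : Rd d → ℝ) (E : Set (Rd d)) (u : Rd d → ℝ) (p x : Rd d) : ℝ :=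
  ∫ y in E,
    (u (x + y) - u x - (ball (0 : Rd d) 1).indicator (fun z => inner ℝ z p) y) * K y

/-- The weight `ω_s(y) = (1 + |y|^{d+2s})^{-1}`. -/
def omegaWeight (d : ℕ) (s : ℝ) (y : Rd d) : ℝ :=
  (1 + ‖y‖ ^ ((d : ℝ) + 2 * s))⁻¹

/-- Membership in `L^1(ω_s)`. -/
def MemL1Omega {d : ℕ} (s : ℝ) (u : Rd d → ℝ) : Prop :=
  LocallyIntegrable u volume ∧ Integrable (fun y => |u y| * omegaWeight d s y) volume

/-- `u` (meant to be in `C(ℝ^d) ∩ L^1(ω_s)`) is a viscosity supersolution of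
`-I u + H(x, ∇u) = g` in `ℝ^d`, with `I = -(-Δ)^s`: whenever `φ` is of class `C^2` in a
neighbourhood of the closed ball of radius `δ` about `x₀`, and `u - φ` has at `x₀` a minimum over
the ball `B_δ(x₀)`, then
`-I[B_δ](φ, ∇φ(x₀), x₀) - I[B_δ^c](u, ∇φ(x₀), x₀) + H(x₀, ∇φ(x₀)) ≥ g(x₀)`. -/
def IsViscositySupersolution {d : ℕ} (s : ℝ) (H : Rd d → Rd d → ℝ) (g u : Rd d → ℝ) : Prop :=
  ∀ (x₀ : Rd d) (δ r : ℝ) (φ : Rd d → ℝ), 0 < δ → δ < r →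
    ContDiffOn ℝ 2 φ (ball x₀ r) →
    IsMinOn (fun x => u x - φ x) (ball x₀ δ) x₀ →
    g x₀ ≤
      -nonlocalEval (fracKernel d s) (ball 0 δ) φ (gradient φ x₀) x₀
        - nonlocalEval (fracKernel d s) (ball 0 δ)ᶜ u (gradient φ x₀) x₀
        + H x₀ (gradient φ x₀)

/-- The two-sided growth condition on the Hamiltonian: for some constant `κ > 0`,
`|p|^m / κ - κ ≤ H(x, p) ≤ κ (1 + |p|^m)` for all `x` and `p`. -/
def HamiltonianGrowth {d : ℕ} (m : ℝ) (H : Rd d → Rd d → ℝ) : Prop :=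
  ∃ κ : ℝ, 0 < κ ∧ ∀ x p : Rd d,
    1 / κ * ‖p‖ ^ m - κ ≤ H x p ∧ H x p ≤ κ * (1 + ‖p‖ ^ m)

/-- `u` is a nonnegative function in `C(ℝ^d) ∩ L^1(ω_s)` with
`-I u + H(x, ∇u) ≥ f - lam` in `ℝ^d`, in the viscosity sense. -/
def IsAdmissible {d : ℕ} (s : ℝ) (H : Rd d → Rd d → ℝ) (f : Rd d → ℝ) (lam : ℝ)
    (u : Rd d → ℝ) : Prop :=
  Continuous u ∧ MemL1Omega s u ∧ (∀ x, 0 ≤ u x) ∧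
    IsViscositySupersolution s H (fun x => f x - lam) u

/-- The critical value `λ*`: the infimum, in the extended real line, of all real `lam` which have a
nonnegative supersolution (so it is `+∞` when there is no such `lam`). -/
def criticalValue {d : ℕ} (s : ℝ) (H : Rd d → Rd d → ℝ) (f : Rd d → ℝ) : EReal :=
  sInf ((fun lam : ℝ => (lam : EReal)) '' {lam : ℝ | ∃ u : Rd d → ℝ, IsAdmissible s H f lam u})

end FracErgodic

end

/-! A nonnegative supersolution `u` must grow so fast that it leaves `L^1(ω_s)`. If `u x₀ < h = ε
r^(2s)` with `r = |x₀|` large, slide under `u` a concave paraboloid of height `h` and radius `ρ =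
r/2`. At the contact point `-I` costs at most a multiple of `h/ρ² + h/ρ`, and `H` at most `κ (1 +
(2h/ρ)^m)`. Since `h/ρ` is of order `ε r^(2s-1)` and `m > 1`, all this is at most `κ + Cε
r^(m(2s-1))`, which for small `ε` is beaten by `f` (`exists_source_le_of_lt`,
`exists_forall_mul_rpow_le`). Hence `u ≥ ε |x|^(2s)` far out, so `u ω_s` is at least a multiple of
`|x|^(-d)`, which just fails to be integrable (`not_memL1Omega_of_mul_rpow_le`). -/

namespace FracErgodic

/-! ### Radial integrability at infinity -/

section Radial

variable {E : Type*} [NormedAddCommGroup E] [NormedSpace ℝ E] [MeasurableSpace E] [Nontrivial E]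
  [FiniteDimensional ℝ E] [BorelSpace E]

/-- Powers of the norm integrable at infinity: exactly those of exponent below `-dim E`. -/
theorem integrableOn_norm_rpow_compl_ball_iff (μ : Measure E) [μ.IsAddHaarMeasure] {a R : ℝ}
    (hR : 0 < R) :
    IntegrableOn (fun y : E => ‖y‖ ^ a) (ball 0 R)ᶜ μ ↔ a < -(Module.finrank ℝ E : ℝ) := by
  have hd : 1 ≤ Module.finrank ℝ E := Module.finrank_pos
  have h1 : IntegrableOn (fun y : E => ‖y‖ ^ a) (ball 0 R)ᶜ μ ↔
      Integrable (fun y : E => (Set.Ici R).indicator (fun t : ℝ => t ^ a) ‖y‖) μ := by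
    rw [← integrable_indicator_iff measurableSet_ball.compl]
    apply integrable_congr
    filter_upwards with y
    simp [Set.indicator]
  -- Polar coordinates contribute the weight `t ^ (dim - 1)`.
  have h2 : IntegrableOn (fun t : ℝ => t ^ (Module.finrank ℝ E - 1) •
        (Set.Ici R).indicator (fun t : ℝ => t ^ a) t) (Set.Ioi 0) ↔
      IntegrableOn (fun t : ℝ => t ^ (((Module.finrank ℝ E - 1 : ℕ) : ℝ) + a)) (Set.Ioi R) := by
    rw [← integrable_indicator_iff measurableSet_Ioi, ← integrableOn_Ici_iff_integrableOn_Ioi,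
      ← integrable_indicator_iff measurableSet_Ici]
    apply integrable_congr
    filter_upwards with t
    by_cases ht : R ≤ t
    · have ht0 : 0 < t := hR.trans_le ht
      simp [Set.indicator, ht, ht0, Real.rpow_add ht0]
    · simp [Set.indicator, ht]
  rw [h1, integrable_fun_norm_addHaar, h2, integrableOn_Ioi_rpow_iff hR]
  push_cast [Nat.cast_sub hd]
  constructor <;> intro h <;> linarith

end Radial

/-! ### The kernel and the far part of the operator -/

variable {d : ℕ} {s : ℝ}

theorem fracConst_nonneg (hs : 0 < s) : 0 ≤ fracConst d s := by
  have : 0 < Real.Gamma ((d : ℝ) / 2 + s) := Real.Gamma_pos_of_pos (by positivity)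
  unfold fracConst
  positivity

theorem fracKernel_nonneg (hs : 0 < s) (y : Rd d) : 0 ≤ fracKernel d s y :=
  mul_nonneg (fracConst_nonneg hs) (by positivity)

theorem measurable_fracKernel : Measurable (fracKernel d s) := by
  unfold fracKernel
  fun_prop

/-- Away from the origin the kernel is dominated by every translate of the weight `ω_s`. -/
theorem fracKernel_le_omegaWeight (hs : 0 < s) (x : Rd d) {y : Rd d} (hy : 1 ≤ ‖y‖) :
    fracKernel d s y ≤
      fracConst d s * (1 + (‖x‖ + 1) ^ ((d : ℝ) + 2 * s)) * omegaWeight d s (x + y) := by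
  have ha : 0 ≤ (d : ℝ) + 2 * s := by positivity
  have hy0 : 0 < ‖y‖ := one_pos.trans_le hy
  have h1 : ‖x + y‖ ≤ (‖x‖ + 1) * ‖y‖ := by
    nlinarith [norm_add_le x y, norm_nonneg x]
  have h2 : 1 + ‖x + y‖ ^ ((d : ℝ) + 2 * s) ≤
      (1 + (‖x‖ + 1) ^ ((d : ℝ) + 2 * s)) * ‖y‖ ^ ((d : ℝ) + 2 * s) := by
    have := Real.rpow_le_rpow (norm_nonneg _) h1 ha
    rw [Real.mul_rpow (by positivity) hy0.le] at this
    have := Real.one_le_rpow hy ha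
    linarith
  unfold fracKernel omegaWeight
  rw [mul_assoc]
  refine mul_le_mul_of_nonneg_left ?_ (fracConst_nonneg hs)
  rw [Real.rpow_neg hy0.le, ← div_eq_mul_inv, le_div_iff₀ (by positivity),
    inv_mul_le_iff₀ (by positivity)]
  linarith

/-- The condition `2s > 1` gives the kernel a finite first moment at infinity, so linear decrease
costs a finite amount. -/
theorem integrableOn_norm_mul_fracKernel (hd : 1 ≤ d) (hs : 1 / 2 < s) :
    IntegrableOn (fun y : Rd d => ‖y‖ * fracKernel d s y) (ball 0 1)ᶜ := by
  have : NeZero d := ⟨by omega⟩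
  have h := ((integrableOn_norm_rpow_compl_ball_iff (E := Rd d) volume
    (a := 1 - ((d : ℝ) + 2 * s)) one_pos).2
      (by rw [finrank_euclideanSpace_fin]; linarith)).const_mul (fracConst d s)
  refine IntegrableOn.congr_fun h (fun y hy => ?_) measurableSet_ball.compl
  have hy0 : 0 < ‖y‖ := one_pos.trans_le (by simpa using hy)
  simp only [fracKernel]
  rw [sub_eq_add_neg, Real.rpow_add hy0, Real.rpow_one, mul_left_comm]

theorem integrableOn_fracKernel (hd : 1 ≤ d) (hs : 1 / 2 < s) :
    IntegrableOn (fracKernel d s) (ball (0 : Rd d) 1)ᶜ := by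
  refine (integrableOn_norm_mul_fracKernel hd hs).mono'
    measurable_fracKernel.aestronglyMeasurable ?_
  filter_upwards [ae_restrict_mem measurableSet_ball.compl] with y hy
  have hK := fracKernel_nonneg (d := d) (by linarith : 0 < s) y
  rw [Real.norm_of_nonneg hK]
  exact le_mul_of_one_le_left hK (by simpa using hy)

/-- The integrand of the far part of the nonlocal operator is integrable on `L^1(ω_s)`. -/
theorem integrableOn_sub_mul_fracKernel (hd : 1 ≤ d) (hs : 1 / 2 < s) {u : Rd d → ℝ}
    (hu : Continuous u) (huL : MemL1Omega s u) (x : Rd d) :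
    IntegrableOn (fun y => (u (x + y) - u x) * fracKernel d s y) (ball 0 1)ᶜ := by
  have hs0 : 0 < s := by linarith
  have h1 : IntegrableOn (fun y => u (x + y) * fracKernel d s y) (ball 0 1)ᶜ := by
    have h := ((huL.2.comp_add_left x).const_mul
      (fracConst d s * (1 + (‖x‖ + 1) ^ ((d : ℝ) + 2 * s)))).integrableOn (s := (ball 0 1)ᶜ)
    refine h.mono' ((by fun_prop : Measurable fun y => u (x + y)).mul
      measurable_fracKernel).aestronglyMeasurable ?_
    filter_upwards [ae_restrict_mem measurableSet_ball.compl] with y hy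
    have hK := fracKernel_nonneg (d := d) hs0 y
    rw [norm_mul, Real.norm_of_nonneg hK, Real.norm_eq_abs, mul_left_comm]
    exact mul_le_mul_of_nonneg_left (fracKernel_le_omegaWeight hs0 x (by simpa using hy))
      (abs_nonneg _)
  simp only [sub_mul]
  exact h1.sub ((integrableOn_fracKernel hd hs).const_mul (u x))

/-- A one-sided Lipschitz bound at `x` bounds the far part of the nonlocal operator from below. -/
theorem neg_mul_integral_le_nonlocalEval_compl_ball (hd : 1 ≤ d) (hs : 1 / 2 < s) {u : Rd d → ℝ}
    (hu : Continuous u) (huL : MemL1Omega s u) (p x : Rd d) {L : ℝ}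
    (hL : ∀ y, 1 ≤ ‖y‖ → -(L * ‖y‖) ≤ u (x + y) - u x) :
    -(L * ∫ y in (ball (0 : Rd d) 1)ᶜ, ‖y‖ * fracKernel d s y) ≤
      nonlocalEval (fracKernel d s) (ball 0 1)ᶜ u p x := by
  have h : nonlocalEval (fracKernel d s) (ball 0 1)ᶜ u p x =
      ∫ y in (ball (0 : Rd d) 1)ᶜ, (u (x + y) - u x) * fracKernel d s y := by
    refine setIntegral_congr_fun measurableSet_ball.compl fun y hy => ?_
    simp only [Set.indicator_of_notMem hy, sub_zero]
  rw [h, ← neg_mul, ← integral_const_mul]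
  refine setIntegral_mono_on ((integrableOn_norm_mul_fracKernel hd hs).const_mul _)
    (integrableOn_sub_mul_fracKernel hd hs hu huL x) measurableSet_ball.compl fun y hy => ?_
  have := mul_le_mul_of_nonneg_right (hL y (by simpa using hy))
    (fracKernel_nonneg (d := d) (by linarith : 0 < s) y)
  linarith

/-! ### Touching from below by paraboloids -/

/-- The concave paraboloid of height `h` and opening `c` with vertex above `x₀`. -/
noncomputable def paraboloid (h c : ℝ) (x₀ x : Rd d) : ℝ := h - c * ‖x - x₀‖ ^ 2

theorem contDiff_paraboloid (h c : ℝ) (x₀ : Rd d) : ContDiff ℝ 2 (paraboloid h c x₀) := by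
  unfold paraboloid
  exact contDiff_const.sub (contDiff_const.mul ((contDiff_id.sub contDiff_const).norm_sq ℝ))

theorem gradient_paraboloid (h c : ℝ) (x₀ x : Rd d) :
    gradient (paraboloid h c x₀) x = (-(2 * c)) • (x - x₀) := by
  apply HasGradientAt.gradient
  rw [hasGradientAt_iff_hasFDerivAt]
  have h1 := (((hasFDerivAt_id x).sub_const x₀).norm_sq.const_mul c).const_sub h
  refine h1.congr_fderiv ?_
  ext v
  simp
  ring

theorem paraboloid_add (h c : ℝ) (x₀ x y : Rd d) :
    paraboloid h c x₀ (x + y) =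
      paraboloid h c x₀ x + inner ℝ y ((-(2 * c)) • (x - x₀)) - c * ‖y‖ ^ 2 := by
  have h1 : x + y - x₀ = (x - x₀) + y := by abel
  simp only [paraboloid, h1, norm_add_sq_real, inner_smul_right, real_inner_comm y]
  ring

theorem nonlocalEval_ball_paraboloid (h c : ℝ) (x₀ x : Rd d) :
    nonlocalEval (fracKernel d s) (ball 0 1) (paraboloid h c x₀)
        (gradient (paraboloid h c x₀) x) x =
      -(c * ∫ y in ball (0 : Rd d) 1, ‖y‖ ^ 2 * fracKernel d s y) := by
  rw [← neg_mul, ← integral_const_mul]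
  refine setIntegral_congr_fun measurableSet_ball fun y hy => ?_
  simp only [Set.indicator_of_mem hy, gradient_paraboloid, paraboloid_add]
  ring

/-- A nonnegative continuous function lying below `h` at `x₀` is touched from below, at a point
`x` within distance `ρ` of `x₀`, by a translate of the paraboloid of height `h` that vanishes on
the sphere of radius `ρ` about `x₀`; at `x` the function is at most `h`. -/
theorem exists_touching_paraboloid {u : Rd d → ℝ} (hu : Continuous u) (hu0 : ∀ x, 0 ≤ u x)
    {x₀ : Rd d} {h ρ : ℝ} (hρ : 0 < ρ) (hh : u x₀ < h) :
    ∃ x, ‖x - x₀‖ ≤ ρ ∧ u x ≤ h ∧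
      ∀ z, u x - paraboloid h (h / ρ ^ 2) x₀ x ≤ u z - paraboloid h (h / ρ ^ 2) x₀ z := by
  have hh0 : 0 < h := (hu0 x₀).trans_lt hh
  set φ := paraboloid h (h / ρ ^ 2) x₀ with hφ
  have hφc : Continuous φ := (contDiff_paraboloid _ _ _).continuous
  obtain ⟨x, hx, hmin⟩ := (isCompact_closedBall x₀ ρ).exists_isMinOn
    ⟨x₀, mem_closedBall_self hρ.le⟩ (hu.sub hφc).continuousOn
  -- Outside the ball `φ ≤ 0 ≤ u`, so a negative minimum over the ball is a global one.
  have hneg : u x - φ x < 0 := by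
    have h1 : u x - φ x ≤ u x₀ - φ x₀ := hmin (mem_closedBall_self hρ.le)
    have h2 : φ x₀ = h := by simp [hφ, paraboloid]
    linarith
  have hle : φ x ≤ h := by
    simp only [hφ, paraboloid]
    linarith [show 0 ≤ h / ρ ^ 2 * ‖x - x₀‖ ^ 2 by positivity]
  refine ⟨x, by simpa [dist_eq_norm] using hx, by linarith, fun z => ?_⟩
  by_cases hz : z ∈ closedBall x₀ ρ
  · exact hmin hz
  · have hz' : ρ < ‖z - x₀‖ := by simpa [dist_eq_norm] using hz
    have : φ z ≤ 0 := by
      have h3 : ρ ^ 2 ≤ ‖z - x₀‖ ^ 2 := by gcongr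
      have h4 : h / ρ ^ 2 * ρ ^ 2 ≤ h / ρ ^ 2 * ‖z - x₀‖ ^ 2 := by gcongr
      rw [div_mul_cancel₀ _ (by positivity)] at h4
      simp only [hφ, paraboloid]
      linarith
    linarith [hu0 z]

/-- A nonnegative supersolution lying below `h` at `x₀` forces the right-hand side to be small
somewhere within distance `ρ` of `x₀`. -/
theorem exists_source_le_of_lt (hd : 1 ≤ d) (hs : 1 / 2 < s) {m κ : ℝ} (hm : 0 ≤ m)
    (hκ : 0 ≤ κ) {H : Rd d → Rd d → ℝ} (hH : ∀ x p, H x p ≤ κ * (1 + ‖p‖ ^ m))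
    {g u : Rd d → ℝ} (hu : Continuous u) (huL : MemL1Omega s u) (hu0 : ∀ x, 0 ≤ u x)
    (hsup : IsViscositySupersolution s H g u) {x₀ : Rd d} {h ρ : ℝ} (hρ : 0 < ρ)
    (hh : u x₀ < h) :
    ∃ x, ‖x - x₀‖ ≤ ρ ∧
      g x ≤ h / ρ ^ 2 * (∫ y in ball (0 : Rd d) 1, ‖y‖ ^ 2 * fracKernel d s y) +
        3 * h / ρ * (∫ y in (ball (0 : Rd d) 1)ᶜ, ‖y‖ * fracKernel d s y) +
        κ * (1 + (2 * h / ρ) ^ m) := by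
  have hh0 : 0 < h := (hu0 x₀).trans_lt hh
  obtain ⟨x, hx, hxh, hmin⟩ := exists_touching_paraboloid hu hu0 hρ hh
  refine ⟨x, hx, ?_⟩
  -- With `δ = 1`, the radius of the gradient cutoff, the near part is explicit and the far part has
  -- no gradient term.
  have hv := hsup x 1 2 (paraboloid h (h / ρ ^ 2) x₀) one_pos one_lt_two
    (contDiff_paraboloid _ _ _).contDiffOn (fun z _ => hmin z)
  rw [nonlocalEval_ball_paraboloid] at hv
  have hp : ‖gradient (paraboloid h (h / ρ ^ 2) x₀) x‖ ≤ 2 * h / ρ := by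
    rw [gradient_paraboloid, norm_smul, norm_neg, Real.norm_of_nonneg (by positivity)]
    calc 2 * (h / ρ ^ 2) * ‖x - x₀‖ ≤ 2 * (h / ρ ^ 2) * ρ := by gcongr
      _ = 2 * h / ρ := by field_simp
  -- For `|y| ≤ ρ` the slope gives `2h/ρ` and the curvature `h/ρ`; for `|y| ≥ ρ` the drop is at most
  -- `u x ≤ h ≤ (h/ρ)|y|`.
  have hfar := neg_mul_integral_le_nonlocalEval_compl_ball hd hs hu huL
    (gradient (paraboloid h (h / ρ ^ 2) x₀) x) x (L := 3 * h / ρ) fun y _ => by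
      rcases le_total ‖y‖ ρ with hy | hy
      · have h1 := hmin (x + y)
        rw [paraboloid_add, ← gradient_paraboloid h] at h1
        have h2 := (abs_le.1 (abs_real_inner_le_norm y
          (gradient (paraboloid h (h / ρ ^ 2) x₀) x))).1
        have h3 := mul_le_mul_of_nonneg_left hp (norm_nonneg y)
        have h4 : h / ρ ^ 2 * ‖y‖ ^ 2 ≤ h / ρ * ‖y‖ := by
          calc h / ρ ^ 2 * ‖y‖ ^ 2 = h / ρ ^ 2 * (‖y‖ * ‖y‖) := by ring
            _ ≤ h / ρ ^ 2 * (ρ * ‖y‖) := by gcongr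
            _ = h / ρ * ‖y‖ := by field_simp
        have h5 : 3 * h / ρ * ‖y‖ = ‖y‖ * (2 * h / ρ) + h / ρ * ‖y‖ := by ring
        linarith
      · have h1 : h ≤ h / ρ * ‖y‖ := by
          calc h = h / ρ * ρ := by field_simp
            _ ≤ h / ρ * ‖y‖ := by gcongr
        have h2 : 3 * h / ρ * ‖y‖ = 3 * (h / ρ * ‖y‖) := by ring
        linarith [hu0 (x + y)]
  have hH1 : H x (gradient (paraboloid h (h / ρ ^ 2) x₀) x) ≤ κ * (1 + (2 * h / ρ) ^ m) :=
    (hH _ _).trans (by gcongr)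
  linarith

/-! ### Growth against integrability -/

/-- Coercivity of the source forces a nonnegative supersolution to grow at least like
`|x|^{2s}`. -/
theorem exists_forall_mul_rpow_le (hd : 1 ≤ d) (hs : 1 / 2 < s) (hs' : s < 1) {m : ℝ}
    (hm : 1 < m) {H : Rd d → Rd d → ℝ} (hH : HamiltonianGrowth m H) {f : Rd d → ℝ}
    {κ₀ κ₁ : ℝ} (hκ₀ : 0 < κ₀)
    (hf : ∀ x : Rd d, κ₁ ≤ ‖x‖ → κ₀ * ‖x‖ ^ (m * (2 * s - 1)) ≤ f x) {lam : ℝ} {u : Rd d → ℝ}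
    (hadm : IsAdmissible s H f lam u) :
    ∃ ε > 0, ∃ R > 0, ∀ x, R ≤ ‖x‖ → ε * ‖x‖ ^ (2 * s) ≤ u x := by
  obtain ⟨hu, huL, hu0, hsup⟩ := hadm
  obtain ⟨κ, hκ, hκH⟩ := hH
  set A := ∫ y in ball (0 : Rd d) 1, ‖y‖ ^ 2 * fracKernel d s y with hA
  set B := ∫ y in (ball (0 : Rd d) 1)ᶜ, ‖y‖ * fracKernel d s y with hB
  have hs0 : 0 < s := by linarith
  have hA0 : 0 ≤ A := integral_nonneg fun y => mul_nonneg (by positivity) (fracKernel_nonneg hs0 y)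
  have hB0 : 0 ≤ B := integral_nonneg fun y => mul_nonneg (by positivity) (fracKernel_nonneg hs0 y)
  set a := m * (2 * s - 1) with ha
  have ha0 : 0 < a := mul_pos (by linarith) (by linarith)
  -- The contact point is only known to satisfy `|x| ≥ r/2`, hence the factor `(1/2)^a`.
  set b := κ₀ * (1 / 2) ^ a with hb
  have hb0 : 0 < b := by positivity
  set D := 4 * A + 6 * B + 4 * κ with hD
  have hD0 : 0 < D := by positivity
  -- `4ε ≤ 1` gives `(4ε)^m ≤ 4ε`; `εD ≤ b/2` lets half of `b r^a` absorb the `ε` terms, the other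
  -- half beating `κ + lam` for `r ≥ R`.
  obtain ⟨ε, hε0, hε1, hεD⟩ : ∃ ε : ℝ, 0 < ε ∧ 4 * ε ≤ 1 ∧ ε * D ≤ b / 2 := by
    refine ⟨min (1 / 4) (b / 2 / D), by positivity, ?_, ?_⟩
    · linarith [min_le_left (1 / 4) (b / 2 / D)]
    · exact (le_div_iff₀ hD0).1 (min_le_right _ _)
  obtain ⟨R, hR⟩ := Filter.eventually_atTop.1
    ((tendsto_rpow_atTop ha0).eventually_gt_atTop ((κ + lam) / (b / 2)))
  refine ⟨ε, hε0, max (max 1 R) (2 * κ₁), by positivity, fun x₀ hx₀ => ?_⟩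
  by_contra! hlt
  set r := ‖x₀‖ with hr
  have hr1 : 1 ≤ r := (le_max_left _ _).trans ((le_max_left _ _).trans hx₀)
  have hrR : R ≤ r := (le_max_right _ _).trans ((le_max_left _ _).trans hx₀)
  have hrκ : 2 * κ₁ ≤ r := (le_max_right _ _).trans hx₀
  have hr0 : 0 < r := one_pos.trans_le hr1
  obtain ⟨x, hx, hgx⟩ := exists_source_le_of_lt hd hs (by linarith) hκ.le
    (fun x p => (hκH x p).2) hu huL hu0 hsup (half_pos hr0) hlt
  rw [← hA, ← hB] at hgx
  have hxr : r / 2 ≤ ‖x‖ := by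
    have := norm_sub_norm_le x₀ x
    rw [norm_sub_rev] at this
    linarith
  have hfx : b * r ^ a ≤ f x := by
    refine le_trans ?_ (hf x (by linarith))
    calc b * r ^ a = κ₀ * (r / 2) ^ a := by
          rw [hb, mul_assoc, ← Real.mul_rpow (by norm_num) hr0.le]
          congr 2
          ring
      _ ≤ κ₀ * ‖x‖ ^ a := by gcongr
  set X := r ^ a with hX
  have hslope : r ^ (2 * s) / r = r ^ (2 * s - 1) := by rw [Real.rpow_sub_one hr0.ne']
  have hpow : r ^ (2 * s - 1) ≤ X := Real.rpow_le_rpow_of_exponent_le hr1 (by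
    rw [ha]
    exact le_mul_of_one_le_left (by linarith) hm.le)
  have hT1 : ε * r ^ (2 * s) / (r / 2) ^ 2 ≤ 4 * ε * X := by
    have : r ^ (2 * s) / r ^ 2 ≤ r ^ (2 * s) / r := by
      gcongr
      nlinarith
    calc ε * r ^ (2 * s) / (r / 2) ^ 2 = 4 * ε * (r ^ (2 * s) / r ^ 2) := by field_simp; ring
      _ ≤ 4 * ε * X := by
        gcongr
        linarith
  have hT2 : 3 * (ε * r ^ (2 * s)) / (r / 2) ≤ 6 * ε * X := by
    calc 3 * (ε * r ^ (2 * s)) / (r / 2) = 6 * ε * (r ^ (2 * s) / r) := by field_simp; ring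
      _ ≤ 6 * ε * X := by
        gcongr
        linarith
  have hT3 : (2 * (ε * r ^ (2 * s)) / (r / 2)) ^ m ≤ 4 * ε * X := by
    have h1 : 2 * (ε * r ^ (2 * s)) / (r / 2) = 4 * ε * r ^ (2 * s - 1) := by
      rw [← hslope]
      field_simp
      ring
    rw [h1, Real.mul_rpow (by positivity) (by positivity), ← Real.rpow_mul hr0.le,
      mul_comm (2 * s - 1) m, ← ha]
    gcongr
    exact Real.rpow_le_self_of_le_one (by positivity) hε1 hm.le
  have h1 := mul_le_mul_of_nonneg_right hT1 hA0
  have h2 := mul_le_mul_of_nonneg_right hT2 hB0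
  have h3 := mul_le_mul_of_nonneg_left hT3 hκ.le
  have hX0 : 0 ≤ X := by positivity
  have h4 := mul_le_mul_of_nonneg_right hεD hX0
  have h5 := (div_lt_iff₀ (half_pos hb0)).1 (hR r hrR)
  have h6 : ε * D * X = 4 * ε * X * A + 6 * ε * X * B + κ * (4 * ε * X) := by rw [hD]; ring
  linarith

/-- Functions growing at least like `|x|^{2s}` are not in `L^1(ω_s)`. -/
theorem not_memL1Omega_of_mul_rpow_le (hd : 1 ≤ d) (hs : 0 < s) {u : Rd d → ℝ} {ε R : ℝ}
    (hε : 0 < ε) (h : ∀ x, R ≤ ‖x‖ → ε * ‖x‖ ^ (2 * s) ≤ u x) : ¬ MemL1Omega s u := by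
  have : NeZero d := ⟨by omega⟩
  rintro ⟨-, hint⟩
  have hR1 : 0 < max R 1 := by positivity
  refine absurd ((integrableOn_norm_rpow_compl_ball_iff (E := Rd d) volume
    (a := -(d : ℝ)) hR1).1 ?_) (by rw [finrank_euclideanSpace_fin]; exact lt_irrefl _)
  refine ((hint.const_mul (2 / ε)).integrableOn (s := (ball 0 (max R 1))ᶜ)).mono'
    (by fun_prop : Measurable fun y : Rd d => ‖y‖ ^ (-(d : ℝ))).aestronglyMeasurable ?_
  filter_upwards [ae_restrict_mem measurableSet_ball.compl] with y hy
  have hy' : R ≤ ‖y‖ ∧ 1 ≤ ‖y‖ := by simpa using hy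
  have hy0 : 0 < ‖y‖ := one_pos.trans_le hy'.2
  have hu : ε * ‖y‖ ^ (2 * s) ≤ |u y| := (h y hy'.1).trans (le_abs_self _)
  -- For `|y| ≥ 1` the power dominates the `1` in the weight.
  have hw : (2 * ‖y‖ ^ ((d : ℝ) + 2 * s))⁻¹ ≤ omegaWeight d s y := by
    unfold omegaWeight
    gcongr
    linarith [Real.one_le_rpow hy'.2 (by positivity : 0 ≤ (d : ℝ) + 2 * s)]
  rw [Real.norm_of_nonneg (by positivity)]
  calc ‖y‖ ^ (-(d : ℝ)) =
        2 / ε * (ε * ‖y‖ ^ (2 * s) * (2 * ‖y‖ ^ ((d : ℝ) + 2 * s))⁻¹) := by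
        rw [Real.rpow_add hy0, Real.rpow_neg hy0.le]
        field_simp
    _ ≤ 2 / ε * (|u y| * omegaWeight d s y) := by gcongr

end FracErgodic

theorem theorem3p9 (d : ℕ) (hd : 1 ≤ d) (s : ℝ) (hs : 1 / 2 < s) (hs' : s < 1)
    (m : ℝ) (hm : 1 < m)
    (H : FracErgodic.Rd d → FracErgodic.Rd d → ℝ) (hHc : Continuous (Function.uncurry H))
    (hH : FracErgodic.HamiltonianGrowth m H)
    (f : FracErgodic.Rd d → ℝ) (hfc : Continuous f)
    (κ₀ κ₁ : ℝ) (hκ₀ : 0 < κ₀)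
    (hf : ∀ x : FracErgodic.Rd d, κ₁ ≤ ‖x‖ → κ₀ * ‖x‖ ^ (m * (2 * s - 1)) ≤ f x) :
    (¬ ∃ (u : FracErgodic.Rd d → ℝ) (lam : ℝ),
        Continuous u ∧ FracErgodic.MemL1Omega s u ∧ (∀ x, 0 ≤ u x) ∧
          FracErgodic.IsViscositySupersolution s H (fun x => f x - lam) u) ∧
      FracErgodic.criticalValue s H f = ⊤ := by
  have key : ∀ (u : FracErgodic.Rd d → ℝ) (lam : ℝ),
      ¬ FracErgodic.IsAdmissible s H f lam u := by
    intro u lam hadm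
    obtain ⟨ε, hε, R, -, hgrow⟩ :=
      FracErgodic.exists_forall_mul_rpow_le hd hs hs' hm hH hκ₀ hf hadm
    exact FracErgodic.not_memL1Omega_of_mul_rpow_le hd (by linarith) hε hgrow hadm.2.1
  refine ⟨fun ⟨u, lam, hadm⟩ => key u lam hadm, ?_⟩
  have hempty : {lam : ℝ | ∃ u, FracErgodic.IsAdmissible s H f lam u} = ∅ :=
    Set.eq_empty_of_forall_notMem fun lam ⟨u, hadm⟩ => key u lam hadm
  simp [FracErgodic.criticalValue, hempty]
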